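/- Let $\mathcal S$ be a finite family of finite sets such that every $s\in\mathcal S$ satisfies $1\le |s|\le 3$ and every non-empty subset of a member of $\mathcal S$ again belongs to $\mathcal S$ (an instance of the hereditary $3$-set packing problem). Put $w(s)=|s|-1$ for a set $s$ and $w(X)=\sum_{s\in X}w(s)$ for $X\subseteq\mathcal S$. A feasible solution is a sub-family $A\subseteq\mathcal S$ of pairwise disjoint sets; an optimum solution is a feasible solution of maximum weight. For $X,A\subseteq\mathcal S$ let $N(X,A)=\{a\in A:\ \exists x\in X,\ x\cap a\neq\emptyset\}$. A family $X\subseteq\mathcal S$ of pairwise disjoint sets is called a local improvement of a feasible solution $A$, of size $|X|$, if either $w(X)>w(N(X,A))$, or $w(X)=w(N(X,A))$ and $X$ contains more sets of weight $2$ than $N(X,A)$. Let $A$ be a feasible solution such that there is no local improvement of $A$ of size at most $10$, and let $B$ be an optimum solution. Then $w(B)\le\frac43\,w(A)$. -/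

import Mathlib

noncomputable section

namespace SetPacking

variable {α : Type*}

/-- `(S, w)` is an instance of the weighted `k`-set packing problem: a finite family of finite sets
of cardinality at most `k`, with non-negative real weights on the members of the family. -/
structure IsWeightedInstance (k : ℕ) (S : Finset (Finset α)) (w : Finset α → ℝ) : Prop where
  card_le : ∀ s ∈ S, s.card ≤ k
  weight_nonneg : ∀ s ∈ S, 0 ≤ w s

/-- A family is hereditary if it contains all non-empty subsets of each of its members. -/
def IsHereditary (S : Finset (Finset α)) : Prop :=
  ∀ s ∈ S, ∀ t : Finset α, t ⊆ s → t.Nonempty → t ∈ S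

/-- The weight `|s| - 1` of a set. -/
def weight (s : Finset α) : ℝ := (s.card : ℝ) - 1

/-- `S` is an instance of the hereditary `3`-set packing problem. Non-negativity of the weights
`|s| - 1` says that the empty set does not belong to `S`. -/
def IsHereditaryThreeInstance (S : Finset (Finset α)) : Prop :=
  IsWeightedInstance 3 S weight ∧ IsHereditary S

/-- The total weight of a family of sets. -/
def totalWeight (X : Finset (Finset α)) : ℝ := ∑ s ∈ X, weight s

/-- Feasible solutions: sub-families consisting of pairwise disjoint sets. -/
def IsFeasible (S A : Finset (Finset α)) : Prop :=
  A ⊆ S ∧ (A : Set (Finset α)).Pairwise Disjoint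

/-- Optimum solutions: feasible solutions of maximum total weight. -/
def IsOptimum (S B : Finset (Finset α)) : Prop :=
  IsFeasible S B ∧ ∀ B' : Finset (Finset α), IsFeasible S B' → totalWeight B' ≤ totalWeight B

/-- The neighborhood `N(U, W)`: the members of `W` that meet some member of `U`. -/
def neighborhood [DecidableEq α] (U W : Finset (Finset α)) : Finset (Finset α) :=
  W.filter fun w => ∃ u ∈ U, (u ∩ w).Nonempty

/-- The number of sets of weight `2` in a family. -/
def numWeightTwo (X : Finset (Finset α)) : ℕ := (X.filter fun s => weight s = 2).card

/-- `X` is a local improvement of `A` (of size `X.card`) in the instance `S`. -/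
def IsLocalImprovement [DecidableEq α] (S A X : Finset (Finset α)) : Prop :=
  (X ⊆ S ∧ (X : Set (Finset α)).Pairwise Disjoint) ∧
    (totalWeight (neighborhood X A) < totalWeight X ∨
      (totalWeight X = totalWeight (neighborhood X A) ∧
        numWeightTwo (neighborhood X A) < numWeightTwo X))

end SetPacking

end

/-!
Every `x` in a member `s` of positive weight of the optimum `B` passes a charge to the member of the
local optimum `A` that contains `x`. The charges out of `s` add up to at least `|s| - 1`, and each
`a ∈ A` receives at most `4/3 * (|a| - 1)`.

An element is free if no member of `A` of positive weight contains it; a member of `B` is loose if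
it contains a free element and tight otherwise. By heredity, any set `U` of elements covered by a
family `P ⊆ B` yields the disjoint sets `b ∩ U`, `b ∈ P`, of total weight `|U| - |P|`, which local
optimality bounds by the weight of the members of `A` that meet `U` (`exchange_bound`). Adding to
`U` a free element of each loose set in `P` cancels the contribution of that set to `|P|`. Hence, if
all elements of a small `T ⊆ A` are covered by `B`, then `T` meets at least `|T|` tight sets
(`card_le_card_tight`). Consequences:

* a set contains at most one free element (`card_free_le_one`);
* a pair of `A` does not have both its elements in loose sets (`pair_not_both_loose`). If one is in
  a loose set and the other one in a tight set, call the latter element bad;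
* a tight set contains at most one bad element (`bad_unique`), and if it is a triple with a bad
  element, it meets a triple of `A` (`exists_inTriple_of_bad`); this uses the second kind of local
  improvement, of equal weight with more triples;
* a triple of `A` has an element outside all loose sets and outside all tight sets with a bad
  element (`triple_exists_cheap`).

A loose set charges `1` through each of its elements. A tight set charges `1/3` through a bad
element; if it has one, it charges `1` through elements in triples of `A`; through all remaining
elements it charges `2/3`. So a pair of `A` receives at most `1 + 1/3` or `2/3 + 2/3`, and a triple
of `A` at most `1 + 1 + 2/3`. A tight triple with a bad element pays at least `1/3 + 1 + 2/3`.
-/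

namespace SetPacking

variable {α : Type*}

/-! ### Free elements and loose sets -/

/-- An element is free if members of `A` containing it, if any, have weight `0`: it can be used by a
new set at no cost. -/
def IsFreeElement (A : Finset (Finset α)) (x : α) : Prop :=
  ∀ a ∈ A, x ∈ a → a.card = 1

/-- The element `x` lies in the member `b` of `B`, and `b` has positive weight. -/
def InBlock (B : Finset (Finset α)) (b : Finset α) (x : α) : Prop :=
  b ∈ B ∧ 2 ≤ b.card ∧ x ∈ b

/-- A set is loose if it contains a free element. -/
def IsLoose (A : Finset (Finset α)) (b : Finset α) : Prop :=
  ∃ x ∈ b, IsFreeElement A x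

lemma mem_unique {S A : Finset (Finset α)} (hA : IsFeasible S A) {a a' : Finset α} {x : α}
    (ha : a ∈ A) (ha' : a' ∈ A) (hx : x ∈ a) (hx' : x ∈ a') : a = a' := by
  by_contra hne
  exact Finset.disjoint_left.1 (hA.2 (Finset.mem_coe.2 ha) (Finset.mem_coe.2 ha') hne) hx hx'

lemma card_pos_of_mem {S : Finset (Finset α)} (hS : IsHereditaryThreeInstance S) {s : Finset α}
    (hs : s ∈ S) : 1 ≤ s.card := by
  have := hS.1.weight_nonneg s hs
  unfold weight at this
  have h : (1 : ℝ) ≤ s.card := by linarith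
  exact_mod_cast h

lemma weight_eq_two_iff (s : Finset α) : weight s = 2 ↔ s.card = 3 := by
  unfold weight
  constructor
  · intro h
    have : (s.card : ℝ) = 3 := by linarith
    exact_mod_cast this
  · intro h
    rw [h]; norm_num

/-! ### The discharging rule -/

/-- `x` is covered by a loose set of positive weight. -/
def IsLooseElement (A B : Finset (Finset α)) (x : α) : Prop :=
  ∃ b, InBlock B b x ∧ IsLoose A b

/-- `x` is covered by a tight set, and the other element of its pair in `A` is covered by a loose
set. -/
def IsBad (A B : Finset (Finset α)) (x : α) : Prop :=
  (∃ b, InBlock B b x ∧ ¬ IsLoose A b) ∧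
    ∃ a ∈ A, a.card = 2 ∧ x ∈ a ∧ ∃ u ∈ a, IsLooseElement A B u

/-- `x` belongs to a member of `A` of weight `2`. -/
def InTriple (A : Finset (Finset α)) (x : α) : Prop :=
  ∃ a ∈ A, a.card = 3 ∧ x ∈ a

open Classical in
/-- The amount that the member of `B` covering `x` pays, via `x`, to the member of `A` covering
`x`. -/
noncomputable def charge (A B : Finset (Finset α)) (x : α) : ℝ :=
  if IsLooseElement A B x then 1
  else if ¬ ∃ b, InBlock B b x then 0
  else if IsBad A B x then 1 / 3
  else if InTriple A x ∧ ∃ b, InBlock B b x ∧ ∃ v ∈ b, IsBad A B v then 1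
  else 2 / 3

lemma InBlock.unique {S B : Finset (Finset α)} (hB : IsFeasible S B) {b b' : Finset α} {x : α}
    (h : InBlock B b x) (h' : InBlock B b' x) : b = b' :=
  mem_unique hB h.1 h'.1 h.2.2 h'.2.2

lemma IsBad.not_looseElement {S A B : Finset (Finset α)} (hB : IsFeasible S B) {x : α}
    (h : IsBad A B x) : ¬ IsLooseElement A B x := by
  rintro ⟨b, hb, hl⟩
  obtain ⟨⟨b', hb', hl'⟩, -⟩ := h
  rw [hb.unique hB hb'] at hl
  exact hl' hl

lemma IsBad.not_inTriple {S A B : Finset (Finset α)} (hA : IsFeasible S A) {x : α}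
    (h : IsBad A B x) : ¬ InTriple A x := by
  rintro ⟨a, ha, h3, hx⟩
  obtain ⟨-, a', ha', h2, hx', -⟩ := h
  rw [mem_unique hA ha ha' hx hx'] at h3
  omega

lemma charge_bounds (A B : Finset (Finset α)) (x : α) : 0 ≤ charge A B x ∧ charge A B x ≤ 1 := by
  unfold charge
  split_ifs <;> norm_num

lemma totalWeight_eq_sum_filter {S X : Finset (Finset α)} (hS : IsHereditaryThreeInstance S)
    (hX : X ⊆ S) : totalWeight X = ∑ s ∈ X.filter (fun s => 2 ≤ s.card), weight s := by
  unfold totalWeight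
  symm
  apply Finset.sum_filter_of_ne
  intro s hs hne
  have := card_pos_of_mem hS (hX hs)
  by_contra h
  have h1 : s.card = 1 := by omega
  exact hne (by simp [weight, h1])

/-! ### Exchanges -/

variable [DecidableEq α]

lemma totalWeight_le_of_subset_union {S N T : Finset (Finset α)}
    (hS : IsHereditaryThreeInstance S) (hT : T ⊆ S)
    (h : ∀ a ∈ N, a ∈ T ∨ a.card = 1) : totalWeight N ≤ totalWeight T := by
  have h1 : totalWeight N = ∑ s ∈ N.filter (· ∈ T), weight s := by
    unfold totalWeight
    symm
    apply Finset.sum_filter_of_ne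
    intro a ha hne
    rcases h a ha with h | h
    · exact h
    · exact absurd (by simp [weight, h]) hne
  rw [h1]
  apply Finset.sum_le_sum_of_subset_of_nonneg
  · intro a ha
    exact (Finset.mem_filter.1 ha).2
  · intro a ha _
    exact hS.1.weight_nonneg a (hT ha)

/-- The members of `P ⊆ B`, shrunk to the elements of `U`, have total weight `|U| - |P|`. By
heredity they form a candidate for a local improvement, which displaces, apart from sets of weight
`0`, only members of `T`. -/
lemma exchange_bound {S A B : Finset (Finset α)}
    (hS : IsHereditaryThreeInstance S) (hA : IsFeasible S A) (hB : IsFeasible S B)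
    (hloc : ¬ ∃ X : Finset (Finset α), IsLocalImprovement S A X ∧ X.card ≤ 10)
    {P T : Finset (Finset α)} {U : Finset α} (hPB : P ⊆ B) (hPcard : P.card ≤ 10)
    (hPU : ∀ b ∈ P, (b ∩ U).Nonempty) (hUP : ∀ u ∈ U, ∃ b ∈ P, u ∈ b) (hTA : T ⊆ A)
    (hT : ∀ u ∈ U, ∀ a ∈ A, u ∈ a → a ∈ T ∨ a.card = 1) :
    (U.card : ℝ) ≤ P.card + totalWeight T ∧
      ((U.card : ℝ) = P.card + totalWeight T →
        numWeightTwo (P.image (· ∩ U)) ≤ numWeightTwo T) := by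
  have hdisj : ∀ b ∈ P, ∀ b' ∈ P, b ≠ b' → Disjoint b b' := fun b hb b' hb' hne =>
    hB.2 (Finset.mem_coe.2 (hPB hb)) (Finset.mem_coe.2 (hPB hb')) hne
  have hinj : Set.InjOn (· ∩ U) (P : Set (Finset α)) := by
    intro b hb b' hb' heq
    obtain ⟨x, hx⟩ := hPU b hb
    have hx' : x ∈ b' ∩ U := by
      have : b ∩ U = b' ∩ U := heq
      rwa [← this]
    exact mem_unique hB (hPB hb) (hPB hb') (Finset.mem_inter.1 hx).1 (Finset.mem_inter.1 hx').1
  have hU : U = P.biUnion (· ∩ U) := by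
    ext u
    simp only [Finset.mem_biUnion, Finset.mem_inter]
    constructor
    · intro hu
      obtain ⟨b, hb, hub⟩ := hUP u hu
      exact ⟨b, hb, hub, hu⟩
    · rintro ⟨_, _, _, hu⟩
      exact hu
  have hUcard : U.card = ∑ b ∈ P, (b ∩ U).card := by
    conv_lhs => rw [hU]
    apply Finset.card_biUnion
    intro b hb b' hb' hne
    exact (hdisj b hb b' hb' hne).mono Finset.inter_subset_left Finset.inter_subset_left
  set X := P.image (· ∩ U) with hX
  have hwX : totalWeight X = U.card - P.card := by
    unfold totalWeight
    rw [hX, Finset.sum_image hinj]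
    unfold weight
    rw [Finset.sum_sub_distrib, hUcard]
    simp
  have hXS : X ⊆ S := by
    intro s hs
    obtain ⟨b, hb, rfl⟩ := Finset.mem_image.1 hs
    exact hS.2 b (hB.1 (hPB hb)) _ Finset.inter_subset_left (hPU b hb)
  have hXdisj : (X : Set (Finset α)).Pairwise Disjoint := by
    intro s hs s' hs' hne
    obtain ⟨b, hb, rfl⟩ := Finset.mem_image.1 (Finset.mem_coe.1 hs)
    obtain ⟨b', hb', rfl⟩ := Finset.mem_image.1 (Finset.mem_coe.1 hs')
    have hbb : b ≠ b' := fun h => hne (by rw [h])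
    exact (hdisj b hb b' hb' hbb).mono Finset.inter_subset_left Finset.inter_subset_left
  have hXcard : X.card ≤ 10 := Finset.card_image_le.trans hPcard
  have hN : ∀ a ∈ neighborhood X A, a ∈ T ∨ a.card = 1 := by
    intro a ha
    obtain ⟨haA, s, hs, x, hx⟩ := Finset.mem_filter.1 ha
    obtain ⟨b, hb, rfl⟩ := Finset.mem_image.1 hs
    simp only [Finset.mem_inter] at hx
    exact hT x hx.1.2 a haA hx.2
  have hNT := totalWeight_le_of_subset_union hS (hTA.trans hA.1) hN
  have hle : totalWeight X ≤ totalWeight (neighborhood X A) := by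
    by_contra hlt
    exact hloc ⟨X, ⟨⟨hXS, hXdisj⟩, Or.inl (not_le.1 hlt)⟩, hXcard⟩
  refine ⟨by linarith, fun heq => ?_⟩
  have hXN : totalWeight X = totalWeight (neighborhood X A) := by linarith
  have hnum : numWeightTwo X ≤ numWeightTwo (neighborhood X A) := by
    by_contra hlt
    exact hloc ⟨X, ⟨⟨hXS, hXdisj⟩, Or.inr ⟨hXN, not_le.1 hlt⟩⟩, hXcard⟩
  refine hnum.trans (Finset.card_le_card fun a ha => ?_)
  obtain ⟨ha, hw⟩ := Finset.mem_filter.1 ha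
  refine Finset.mem_filter.2 ⟨(hN a ha).resolve_right fun h => ?_, hw⟩
  rw [weight_eq_two_iff] at hw
  omega

/-- Each loose set met by `C` can be enlarged by one of its free elements, which pays for the loss
of `1` in its weight `|s| - 1`. So only the tight sets in `Q` count on the right-hand side. -/
lemma card_le_tight_add_weight {S A B : Finset (Finset α)}
    (hS : IsHereditaryThreeInstance S) (hA : IsFeasible S A) (hB : IsFeasible S B)
    (hloc : ¬ ∃ X : Finset (Finset α), IsLocalImprovement S A X ∧ X.card ≤ 10)
    {Q T : Finset (Finset α)} {C : Finset α} (hC : C.card ≤ 10)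
    (hCfree : ∀ x ∈ C, ¬ IsFreeElement A x)
    (hCB : ∀ x ∈ C, ∃ b, InBlock B b x)
    (hQ : ∀ x ∈ C, ∀ b, InBlock B b x → b ∈ Q ∨ IsLoose A b) (hTA : T ⊆ A)
    (hT : ∀ u ∈ C, ∀ a ∈ A, u ∈ a → a ∈ T ∨ a.card = 1) :
    (C.card : ℝ) ≤ Q.card + totalWeight T ∧
      ((C.card : ℝ) = Q.card + totalWeight T →
        (∃ b ∈ B, b.card = 3 ∧ b ⊆ C) → 1 ≤ numWeightTwo T) := by
  classical
  rcases C.eq_empty_or_nonempty with rfl | ⟨x₀, -⟩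
  · have h0 : 0 ≤ totalWeight T :=
      Finset.sum_nonneg fun a ha => hS.1.weight_nonneg a (hA.1 (hTA ha))
    refine ⟨?_, ?_⟩
    · have : (0 : ℝ) ≤ Q.card := Nat.cast_nonneg _
      simp only [Finset.card_empty, Nat.cast_zero]
      linarith
    · rintro - ⟨b, -, hb3, hbC⟩
      rw [Finset.subset_empty.1 hbC] at hb3
      simp at hb3
  have : Nonempty α := ⟨x₀⟩
  choose! β hβ using hCB
  choose! φ hφ using fun (b : Finset α) (h : IsLoose A b) => h
  -- `β x` is the member of `B` covering `x`, and `φ b` is a free element of a loose set `b`.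
  set P := C.image β with hP
  set L := P.filter (IsLoose A) with hL
  set U := C ∪ L.image φ with hU
  have hPB : P ⊆ B := by
    intro b hb
    obtain ⟨x, hx, rfl⟩ := Finset.mem_image.1 hb
    exact (hβ x hx).1
  have hLP : L ⊆ P := Finset.filter_subset _ _
  have hφL : ∀ b ∈ L, φ b ∈ b ∧ IsFreeElement A (φ b) := fun b hb =>
    hφ b (Finset.mem_filter.1 hb).2
  have hUcard : U.card = C.card + L.card := by
    rw [hU, Finset.card_union_of_disjoint, Finset.card_image_of_injOn]
    · intro b hb b' hb' heq
      have h1 := (hφL b hb).1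
      have h2 := (hφL b' hb').1
      rw [← heq] at h2
      exact mem_unique hB (hPB (hLP hb)) (hPB (hLP hb')) h1 h2
    · rw [Finset.disjoint_left]
      intro x hx hx'
      obtain ⟨b, hb, rfl⟩ := Finset.mem_image.1 hx'
      exact hCfree _ hx (hφL b hb).2
  have hPQ : P.card ≤ Q.card + L.card := by
    refine (Finset.card_le_card (t := Q ∪ L) fun b hb => ?_).trans (Finset.card_union_le _ _)
    obtain ⟨x, hx, rfl⟩ := Finset.mem_image.1 hb
    rcases hQ x hx _ (hβ x hx) with h | h
    · exact Finset.mem_union_left _ h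
    · exact Finset.mem_union_right _ (Finset.mem_filter.2 ⟨hb, h⟩)
  have key := exchange_bound hS hA hB hloc (P := P) (T := T) (U := U) hPB
    (Finset.card_image_le.trans hC)
    (by
      intro b hb
      obtain ⟨x, hx, rfl⟩ := Finset.mem_image.1 hb
      exact ⟨x, Finset.mem_inter.2 ⟨(hβ x hx).2.2, Finset.mem_union_left _ hx⟩⟩)
    (by
      intro u hu
      rcases Finset.mem_union.1 hu with hu | hu
      · exact ⟨β u, Finset.mem_image_of_mem _ hu, (hβ u hu).2.2⟩
      · obtain ⟨b, hb, rfl⟩ := Finset.mem_image.1 hu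
        exact ⟨b, hLP hb, (hφL b hb).1⟩)
    hTA
    (by
      intro u hu a ha hua
      rcases Finset.mem_union.1 hu with hu | hu
      · exact hT u hu a ha hua
      · obtain ⟨b, hb, rfl⟩ := Finset.mem_image.1 hu
        exact Or.inr ((hφL b hb).2 a ha hua))
  have hUr : (U.card : ℝ) = C.card + L.card := by exact_mod_cast hUcard
  have hPr : (P.card : ℝ) ≤ Q.card + L.card := by exact_mod_cast hPQ
  refine ⟨by linarith [key.1], ?_⟩
  rintro heq ⟨b, hb, hb3, hbC⟩
  refine le_trans ?_ (key.2 (by linarith [key.1]))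
  refine Finset.card_pos.2 ⟨b, Finset.mem_filter.2 ⟨?_, (weight_eq_two_iff b).2 hb3⟩⟩
  obtain ⟨x, hx⟩ : b.Nonempty := Finset.card_pos.1 (by omega)
  have hβx : β x = b := mem_unique hB (hβ x (hbC hx)).1 hb (hβ x (hbC hx)).2.2 hx
  refine Finset.mem_image.2 ⟨b, Finset.mem_image.2 ⟨x, hbC hx, hβx⟩, ?_⟩
  exact Finset.inter_eq_left.2 (hbC.trans Finset.subset_union_left)

/-- A Hall type condition: few sets of positive weight in `A`, all of whose elements are covered by
sets of positive weight in `B`, meet at least as many tight sets. -/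
lemma card_le_card_tight {S A B : Finset (Finset α)}
    (hS : IsHereditaryThreeInstance S) (hA : IsFeasible S A) (hB : IsFeasible S B)
    (hloc : ¬ ∃ X : Finset (Finset α), IsLocalImprovement S A X ∧ X.card ≤ 10)
    {Q T : Finset (Finset α)} (hTA : T ⊆ A) (hT2 : ∀ a ∈ T, 2 ≤ a.card)
    (hC : ∑ a ∈ T, a.card ≤ 10)
    (hTB : ∀ a ∈ T, ∀ x ∈ a, ∃ b, InBlock B b x)
    (hQ : ∀ a ∈ T, ∀ x ∈ a, ∀ b, InBlock B b x → b ∈ Q ∨ IsLoose A b) :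
    T.card ≤ Q.card := by
  have hcard : (T.biUnion id).card = ∑ a ∈ T, a.card := by
    apply Finset.card_biUnion
    intro a ha a' ha' hne
    exact hA.2 (Finset.mem_coe.2 (hTA ha)) (Finset.mem_coe.2 (hTA ha')) hne
  have key := (card_le_tight_add_weight hS hA hB hloc (Q := Q) (T := T) (C := T.biUnion id)
    (by omega)
    (by
      intro x hx hf
      obtain ⟨a, ha, hxa⟩ := Finset.mem_biUnion.1 hx
      have := hf a (hTA ha) hxa
      have := hT2 a ha
      omega)
    (by
      intro x hx
      obtain ⟨a, ha, hxa⟩ := Finset.mem_biUnion.1 hx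
      exact hTB a ha x hxa)
    (by
      intro x hx
      obtain ⟨a, ha, hxa⟩ := Finset.mem_biUnion.1 hx
      exact hQ a ha x hxa) hTA
    (by
      intro x hx a' ha' hxa'
      obtain ⟨a, ha, hxa⟩ := Finset.mem_biUnion.1 hx
      rw [mem_unique hA ha' (hTA ha) hxa' hxa]
      exact Or.inl ha)).1
  have hw : totalWeight T = (T.biUnion id).card - (T.card : ℝ) := by
    unfold totalWeight weight
    rw [Finset.sum_sub_distrib, hcard]
    simp
  have : (T.card : ℝ) ≤ Q.card := by linarith
  exact_mod_cast this

lemma IsBad.exists_pair {S A B : Finset (Finset α)} (hB : IsFeasible S B) {x : α}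
    (h : IsBad A B x) : ∃ u, u ≠ x ∧ ({u, x} : Finset α) ∈ A ∧ IsLooseElement A B u := by
  have hx := h.not_looseElement hB
  obtain ⟨-, a, ha, h2, hxa, u, hua, hu⟩ := h
  have hne : u ≠ x := fun h => hx (h ▸ hu)
  refine ⟨u, hne, ?_, hu⟩
  rwa [Finset.eq_of_subset_of_card_le (s := {u, x}) (t := a)]
  · intro y hy
    rcases Finset.mem_insert.1 hy with rfl | hy
    · exact hua
    · rwa [Finset.mem_singleton.1 hy]
  · rw [h2, Finset.card_pair hne]

/-! ### Structure of a local optimum -/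

section LocalOptimum

variable {S A B : Finset (Finset α)} (hS : IsHereditaryThreeInstance S) (hA : IsFeasible S A)
  (hB : IsFeasible S B)
  (hloc : ¬ ∃ X : Finset (Finset α), IsLocalImprovement S A X ∧ X.card ≤ 10)

include hS hA hB hloc

/-- Two free elements of one set would form a pair that displaces nothing of positive weight. -/
lemma card_free_le_one {b F : Finset α} (hb : b ∈ B) (hFb : F ⊆ b)
    (hF : ∀ x ∈ F, IsFreeElement A x) : F.card ≤ 1 := by
  rcases F.eq_empty_or_nonempty with rfl | ⟨x, hx⟩
  · simp
  have := (exchange_bound hS hA hB hloc (P := {b}) (T := ∅) (U := F)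
    (Finset.singleton_subset_iff.2 hb) (by simp)
    (by
      intro b' hb'
      rw [Finset.mem_singleton.1 hb']
      exact ⟨x, Finset.mem_inter.2 ⟨hFb hx, hx⟩⟩)
    (fun u hu => ⟨b, Finset.mem_singleton_self b, hFb hu⟩) (Finset.empty_subset _)
    (fun u hu a ha hua => Or.inr (hF u hu a ha hua))).1
  simp only [Finset.card_singleton, totalWeight, Finset.sum_empty, Nat.cast_one, add_zero] at this
  exact_mod_cast this

lemma pair_not_both_loose {a : Finset α} (ha : a ∈ A) (h2 : a.card = 2) :
    ∃ x ∈ a, ¬ IsLooseElement A B x := by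
  by_contra! h
  have := card_le_card_tight hS hA hB hloc (Q := ∅) (T := {a})
    (Finset.singleton_subset_iff.2 ha) (by simp [h2]) (by simp [h2])
    (by
      intro a' ha' x hx
      rw [Finset.mem_singleton.1 ha'] at hx
      obtain ⟨b, hb, -⟩ := h x hx
      exact ⟨b, hb⟩)
    (by
      intro a' ha' x hx b hb
      rw [Finset.mem_singleton.1 ha'] at hx
      obtain ⟨b', hb', hl⟩ := h x hx
      rw [hb.unique hB hb']
      exact Or.inr hl)
  simp at this

/-- Two bad elements of one tight set would belong to two pairs that meet only one tight set. -/
lemma bad_unique {b : Finset α} {x y : α} (hx : InBlock B b x) (hy : InBlock B b y)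
    (hxb : IsBad A B x) (hyb : IsBad A B y) : x = y := by
  by_contra hne
  obtain ⟨u, hu, huA, hul⟩ := hxb.exists_pair hB
  obtain ⟨v, hv, hvA, hvl⟩ := hyb.exists_pair hB
  have hp : ({u, x} : Finset α) ≠ {v, y} := by
    intro h
    have : y ∈ ({u, x} : Finset α) := by rw [h]; simp
    simp only [Finset.mem_insert, Finset.mem_singleton] at this
    rcases this with rfl | rfl
    · exact hyb.not_looseElement hB hul
    · exact hne rfl
  have := card_le_card_tight hS hA hB hloc (Q := {b}) (T := {{u, x}, {v, y}})
    (by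
      intro a ha
      simp only [Finset.mem_insert, Finset.mem_singleton] at ha
      rcases ha with rfl | rfl <;> assumption)
    (by
      intro a ha
      simp only [Finset.mem_insert, Finset.mem_singleton] at ha
      rcases ha with rfl | rfl
      · rw [Finset.card_pair hu]
      · rw [Finset.card_pair hv])
    (by
      rw [Finset.sum_pair hp, Finset.card_pair hu, Finset.card_pair hv]
      omega)
    (by
      obtain ⟨c, hc, -⟩ := hul
      obtain ⟨d, hd, -⟩ := hvl
      intro a ha z hz
      simp only [Finset.mem_insert, Finset.mem_singleton] at ha
      rcases ha with rfl | rfl <;> simp only [Finset.mem_insert, Finset.mem_singleton] at hz <;>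
        rcases hz with rfl | rfl
      exacts [⟨c, hc⟩, ⟨b, hx⟩, ⟨d, hd⟩, ⟨b, hy⟩])
    (by
      obtain ⟨c, hc, hcl⟩ := hul
      obtain ⟨d, hd, hdl⟩ := hvl
      intro a ha z hz b' hb'
      simp only [Finset.mem_insert, Finset.mem_singleton] at ha
      rcases ha with rfl | rfl <;> simp only [Finset.mem_insert, Finset.mem_singleton] at hz <;>
        rcases hz with rfl | rfl
      · rw [hb'.unique hB hc]; exact Or.inr hcl
      · rw [hb'.unique hB hx]; simp
      · rw [hb'.unique hB hd]; exact Or.inr hdl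
      · rw [hb'.unique hB hy]; simp)
  rw [Finset.card_pair hp] at this
  simp at this

/-- If a tight triple with a bad element met only pairs of `A`, then exchanging those pairs for the
triple and a pair from a loose set would not decrease the weight, and it would increase the number
of sets of weight `2`. -/
lemma exists_inTriple_of_bad {b : Finset α} {v : α} (hb3 : b.card = 3) (hv : InBlock B b v)
    (hvb : IsBad A B v) : ∃ y ∈ b, InTriple A y := by
  by_contra! hno
  obtain ⟨u, hu, huA, c, hc, hcl⟩ := hvb.exists_pair hB
  obtain ⟨⟨b', hb', htight⟩, -⟩ := hvb
  rw [← hv.unique hB hb'] at htight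
  -- The exchange uses the elements `insert u b`: four of them, meeting only the tight set `b` and
  -- displacing at most three pairs, so the bound holds with equality.
  have hex : ∀ y ∈ b, ∃ a ∈ A, y ∈ a ∧ a.card = 2 := by
    intro y hy
    have hnf : ¬ IsFreeElement A y := fun h => htight ⟨y, hy, h⟩
    unfold IsFreeElement at hnf
    push Not at hnf
    obtain ⟨a, ha, hya, h1⟩ := hnf
    refine ⟨a, ha, hya, ?_⟩
    have h3 := hS.1.card_le a (hA.1 ha)
    have h0 := card_pos_of_mem hS (hA.1 ha)
    have : a.card ≠ 3 := fun h => hno y hy ⟨a, ha, h, hya⟩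
    omega
  choose! f hfA hfm hf2 using hex
  set T := b.image f with hT
  have hTA : T ⊆ A := by
    intro a ha
    obtain ⟨y, hy, rfl⟩ := Finset.mem_image.1 ha
    exact hfA y hy
  have hT2 : ∀ a ∈ T, a.card = 2 := by
    intro a ha
    obtain ⟨y, hy, rfl⟩ := Finset.mem_image.1 ha
    exact hf2 y hy
  have hwT : totalWeight T = T.card := by
    unfold totalWeight
    rw [Finset.sum_congr rfl (g := fun _ => (1 : ℝ))]
    · simp
    · intro a ha
      rw [weight, hT2 a ha]
      norm_num
  have hTcard : T.card ≤ 3 := hb3 ▸ Finset.card_image_le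
  have hub : u ∉ b := by
    intro hub
    have hbu : InBlock B b u := ⟨hv.1, hv.2.1, hub⟩
    rw [hc.unique hB hbu] at hcl
    exact htight hcl
  have hfv : f v = {u, v} := mem_unique hA (hfA v hv.2.2) huA (hfm v hv.2.2) (by simp)
  have hCf : ∀ x ∈ insert u b, ∃ a ∈ T, x ∈ a := by
    intro x hx
    rcases Finset.mem_insert.1 hx with rfl | hx
    · exact ⟨f v, Finset.mem_image_of_mem _ hv.2.2, by rw [hfv]; simp⟩
    · exact ⟨f x, Finset.mem_image_of_mem _ hx, hfm x hx⟩
  have key := card_le_tight_add_weight hS hA hB hloc (Q := {b}) (T := T) (C := insert u b)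
    (by rw [Finset.card_insert_of_notMem hub]; omega)
    (by
      intro x hx hf
      obtain ⟨a, ha, hxa⟩ := hCf x hx
      have := hf a (hTA ha) hxa
      have := hT2 a ha
      omega)
    (by
      intro x hx
      rcases Finset.mem_insert.1 hx with rfl | hx
      · exact ⟨c, hc⟩
      · exact ⟨b, hv.1, hv.2.1, hx⟩)
    (by
      intro x hx b' hb'
      rcases Finset.mem_insert.1 hx with rfl | hx
      · rw [hb'.unique hB hc]; exact Or.inr hcl
      · have hbx : InBlock B b x := ⟨hv.1, hv.2.1, hx⟩
        rw [hb'.unique hB hbx]; simp)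
    hTA
    (by
      intro x hx a' ha' hxa'
      obtain ⟨a, ha, hxa⟩ := hCf x hx
      rw [mem_unique hA ha' (hTA ha) hxa' hxa]
      exact Or.inl ha)
  rw [Finset.card_insert_of_notMem hub, hb3, hwT, Finset.card_singleton] at key
  have hTr : (T.card : ℝ) ≤ 3 := by exact_mod_cast hTcard
  have h1 := key.2 (by push_cast; push_cast at key; linarith [key.1])
    ⟨b, hv.1, hb3, Finset.subset_insert _ _⟩
  obtain ⟨a, ha⟩ := Finset.card_pos.1 h1
  obtain ⟨ha, hw⟩ := Finset.mem_filter.1 ha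
  have := hT2 a ha
  rw [weight_eq_two_iff] at hw
  omega

/-- Otherwise the triple, together with the pairs that contain the bad elements of the tight sets
meeting it, would meet too few tight sets. -/
lemma triple_exists_cheap {a : Finset α} (ha : a ∈ A) (h3 : a.card = 3) :
    ∃ x ∈ a, ¬ IsLooseElement A B x ∧ ¬ ∃ b, InBlock B b x ∧ ∃ v ∈ b, IsBad A B v := by
  classical
  obtain ⟨x₀, -⟩ : a.Nonempty := Finset.card_pos.1 (by omega)
  have : Nonempty α := ⟨x₀⟩
  by_contra! h
  choose! β hβ using fun (x : α) (hx : x ∈ a) (hl : ¬ IsLooseElement A B x) => h x hx hl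
  set Q := (a.filter fun x => ¬ IsLooseElement A B x).image β with hQ
  have hQb : ∀ b ∈ Q, ∃ v, InBlock B b v ∧ IsBad A B v := by
    intro b hb
    obtain ⟨x, hx, rfl⟩ := Finset.mem_image.1 hb
    obtain ⟨hx, hl⟩ := Finset.mem_filter.1 hx
    obtain ⟨hxb, v, hv, hvb⟩ := hβ x hx hl
    exact ⟨v, ⟨hxb.1, hxb.2.1, hv⟩, hvb⟩
  have hQp : ∀ b ∈ Q, ∃ p ∈ A, p.card = 2 ∧ ∃ v u, p = {u, v} ∧ InBlock B b v ∧ IsBad A B v ∧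
      IsLooseElement A B u := by
    intro b hb
    obtain ⟨v, hv, hvb⟩ := hQb b hb
    obtain ⟨u, hu, huA, hul⟩ := hvb.exists_pair hB
    exact ⟨_, huA, Finset.card_pair hu, v, u, rfl, hv, hvb, hul⟩
  choose! p hpA hp2 v u hp hv hvb hul using hQp
  -- The pair `p b` determines `b`: its only element outside loose sets is the bad element of `b`.
  have hinj : Set.InjOn p (Q : Set (Finset α)) := by
    intro b hb b' hb' heq
    have hvm : v b ∈ p b' := by rw [← heq, hp b hb]; simp
    rw [hp b' hb'] at hvm
    simp only [Finset.mem_insert, Finset.mem_singleton] at hvm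
    rcases hvm with h | h
    · exact absurd (h ▸ hul b' hb') ((hvb b hb).not_looseElement hB)
    · have := hv b' hb'
      rw [← h] at this
      exact (hv b hb).unique hB this
  have hapQ : a ∉ Q.image p := by
    intro hm
    obtain ⟨b, hb, heq⟩ := Finset.mem_image.1 hm
    have := hp2 b hb
    rw [heq] at this
    omega
  have hQ3 : Q.card ≤ 3 :=
    Finset.card_image_le.trans ((Finset.card_filter_le _ _).trans h3.le)
  have hcov : ∀ t ∈ insert a (Q.image p), ∀ x ∈ t, ∃ b, InBlock B b x ∧ (b ∈ Q ∨ IsLoose A b) := by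
    intro t ht x hx
    rcases Finset.mem_insert.1 ht with rfl | ht
    · by_cases hl : IsLooseElement A B x
      · obtain ⟨b, hb, hbl⟩ := hl
        exact ⟨b, hb, Or.inr hbl⟩
      · exact ⟨β x, (hβ x hx hl).1,
          Or.inl (Finset.mem_image_of_mem _ (Finset.mem_filter.2 ⟨hx, hl⟩))⟩
    · obtain ⟨b, hb, rfl⟩ := Finset.mem_image.1 ht
      rw [hp b hb] at hx
      simp only [Finset.mem_insert, Finset.mem_singleton] at hx
      rcases hx with rfl | rfl
      · obtain ⟨c, hc, hcl⟩ := hul b hb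
        exact ⟨c, hc, Or.inr hcl⟩
      · exact ⟨b, hv b hb, Or.inl hb⟩
  have key := card_le_card_tight hS hA hB hloc (Q := Q) (T := insert a (Q.image p))
    (by
      intro t ht
      rcases Finset.mem_insert.1 ht with rfl | ht
      · exact ha
      · obtain ⟨b, hb, rfl⟩ := Finset.mem_image.1 ht
        exact hpA b hb)
    (by
      intro t ht
      rcases Finset.mem_insert.1 ht with rfl | ht
      · omega
      · obtain ⟨b, hb, rfl⟩ := Finset.mem_image.1 ht
        exact (hp2 b hb).ge)
    (by
      rw [Finset.sum_insert hapQ, Finset.sum_image hinj, Finset.sum_congr rfl hp2]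
      simp only [Finset.sum_const, smul_eq_mul]
      omega)
    (fun t ht x hx => let ⟨b, hb, _⟩ := hcov t ht x hx; ⟨b, hb⟩)
    (by
      intro t ht x hx b' hb'
      obtain ⟨b, hb, h⟩ := hcov t ht x hx
      rwa [hb'.unique hB hb])
  rw [Finset.card_insert_of_notMem hapQ, Finset.card_image_of_injOn hinj] at key
  omega

/-! ### The two sides of the charging -/

/-- Every member of `A` receives at most `4/3` of its weight. -/
lemma sum_charge_le {a : Finset α} (ha : a ∈ A) (h2 : 2 ≤ a.card) :
    ∑ x ∈ a, charge A B x ≤ 4 / 3 * weight a := by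
  have h3 := hS.1.card_le a (hA.1 ha)
  obtain h2 | h3 : a.card = 2 ∨ a.card = 3 := by omega
  · have hpair : ∀ x ∈ a, ∀ y ∈ a, ¬ IsLooseElement A B y →
        charge A B x + charge A B y ≤ 4 / 3 := by
      intro x hx y hy hyl
      have hnt : ∀ z ∈ a, ¬ InTriple A z := by
        rintro z hz ⟨a', ha', h3, hz'⟩
        rw [mem_unique hA ha' ha hz' hz] at h3
        omega
      have hxt := hnt x hx
      have hyt := hnt y hy
      by_cases hxl : IsLooseElement A B x
      · by_cases hyc : ∃ b, InBlock B b y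
        · have hbad : IsBad A B y := by
            obtain ⟨b, hb⟩ := hyc
            exact ⟨⟨b, hb, fun h => hyl ⟨b, hb, h⟩⟩, a, ha, h2, hy, x, hx, hxl⟩
          simp only [charge, hxl, hyl, hyc, hbad, if_true, if_false, not_true]
          norm_num
        · simp only [charge, hxl, hyl, hyc, if_true, if_false, not_false_iff]
          norm_num
      · simp only [charge, hxl, hyl, hxt, hyt, false_and, if_false]
        split_ifs <;> norm_num
    obtain ⟨x, y, hxy, rfl⟩ := Finset.card_eq_two.1 h2
    rw [Finset.sum_pair hxy, weight, h2]
    obtain ⟨z, hz, hzl⟩ := pair_not_both_loose hS hA hB hloc ha h2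
    simp only [Finset.mem_insert, Finset.mem_singleton] at hz
    rcases hz with rfl | rfl
    · have := hpair y (by simp) z (by simp) hzl
      push_cast
      linarith
    · have := hpair x (by simp) z (by simp) hzl
      push_cast
      linarith
  · obtain ⟨z, hz, hzl, hzb⟩ := triple_exists_cheap hS hA hB hloc ha h3
    have hcz : charge A B z ≤ 2 / 3 := by
      simp only [charge, hzl, hzb, and_false, if_false]
      split_ifs <;> norm_num
    rw [← Finset.add_sum_erase _ _ hz, weight, h3]
    have : ∑ x ∈ a.erase z, charge A B x ≤ ∑ x ∈ a.erase z, (1 : ℝ) :=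
      Finset.sum_le_sum fun x _ => (charge_bounds A B x).2
    rw [Finset.sum_const, Finset.card_erase_of_mem hz, h3] at this
    norm_num at this ⊢
    linarith

open Classical in
/-- Every member of `B` of positive weight pays at least its weight, and it pays through elements
of members of `A` of positive weight. -/
lemma weight_le_sum_charge {b : Finset α} (hb : b ∈ B) (h2 : 2 ≤ b.card) :
    weight b ≤ ∑ x ∈ b.filter (fun x => ¬ IsFreeElement A x), charge A B x := by
  have hin : ∀ x ∈ b, InBlock B b x := fun x hx => ⟨hb, h2, hx⟩
  by_cases hl : IsLoose A b
  · rw [Finset.sum_congr rfl (g := fun _ => (1 : ℝ))]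
    · have hf := card_free_le_one hS hA hB hloc hb (Finset.filter_subset (IsFreeElement A) b)
        (fun x hx => (Finset.mem_filter.1 hx).2)
      have hs := Finset.card_filter_add_card_filter_not (s := b) (IsFreeElement A)
      have : (b.card : ℝ) ≤ 1 + (b.filter fun x => ¬ IsFreeElement A x).card := by
        exact_mod_cast (by omega)
      simp only [weight, Finset.sum_const, nsmul_eq_mul, mul_one]
      linarith
    · intro x hx
      exact if_pos ⟨b, hin x (Finset.mem_filter.1 hx).1, hl⟩
  · rw [Finset.filter_true_of_mem (p := fun x => ¬ IsFreeElement A x)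
      fun x hx hf => hl ⟨x, hx, hf⟩]
    have hnl : ∀ x ∈ b, ¬ IsLooseElement A B x := by
      rintro x hx ⟨b', hb', hl'⟩
      rw [hb'.unique hB (hin x hx)] at hl'
      exact hl hl'
    have hcov : ∀ x ∈ b, ∃ b, InBlock B b x := fun x hx => ⟨b, hin x hx⟩
    have hbad : ∀ x ∈ b, IsBad A B x → charge A B x = 1 / 3 := by
      intro x hx h
      simp only [charge, hnl x hx, hcov x hx, h, if_true, if_false, not_true]
    have hgood : ∀ x ∈ b, ¬ IsBad A B x → 2 / 3 ≤ charge A B x := by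
      intro x hx h
      simp only [charge, hnl x hx, hcov x hx, h, if_false, not_true]
      split_ifs <;> norm_num
    by_cases hv : ∃ v ∈ b, IsBad A B v
    · obtain ⟨v, hvb, hvbad⟩ := hv
      have hother : ∀ x ∈ b.erase v, 2 / 3 ≤ charge A B x := by
        intro x hx
        obtain ⟨hne, hx⟩ := Finset.mem_erase.1 hx
        exact hgood x hx fun h =>
          hne (bad_unique hS hA hB hloc (hin x hx) (hin v hvb) h hvbad)
      rw [← Finset.add_sum_erase _ _ hvb, hbad v hvb hvbad]
      have hcard := Finset.card_erase_of_mem hvb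
      have h3 := hS.1.card_le b (hB.1 hb)
      obtain h2 | h3 : b.card = 2 ∨ b.card = 3 := by omega
      · have := Finset.card_nsmul_le_sum _ _ _ hother
        rw [hcard, h2] at this
        rw [weight, h2]
        norm_num at this ⊢
        linarith
      · obtain ⟨y, hy, hyt⟩ := exists_inTriple_of_bad hS hA hB hloc h3 (hin v hvb) hvbad
        have hyb : ¬ IsBad A B y := fun h => h.not_inTriple hA hyt
        have hyv : y ≠ v := fun h => hyb (h ▸ hvbad)
        have hyc : charge A B y = 1 := by
          have hy' : ∃ b, InBlock B b y ∧ ∃ v ∈ b, IsBad A B v := ⟨b, hin y hy, v, hvb, hvbad⟩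
          simp only [charge, hnl y hy, hcov y hy, hyb, hyt, hy', if_true, if_false, not_true,
            and_self]
        have hye : y ∈ b.erase v := Finset.mem_erase.2 ⟨hyv, hy⟩
        rw [← Finset.add_sum_erase _ _ hye, hyc]
        have := Finset.card_nsmul_le_sum _ _ _
          fun x (hx : x ∈ (b.erase v).erase y) => hother x (Finset.mem_of_mem_erase hx)
        rw [Finset.card_erase_of_mem hye, hcard, h3] at this
        rw [weight, h3]
        norm_num at this ⊢
        linarith
    · push Not at hv
      have := Finset.card_nsmul_le_sum _ _ _ fun x hx => hgood x hx (hv x hx)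
      have h3 : (b.card : ℝ) ≤ 3 := by exact_mod_cast hS.1.card_le b (hB.1 hb)
      rw [nsmul_eq_mul] at this
      rw [weight]
      linarith

end LocalOptimum

end SetPacking

theorem mainTheorem1 {α : Type*} [DecidableEq α] (S A B : Finset (Finset α))
    (hS : SetPacking.IsHereditaryThreeInstance S)
    (hA : SetPacking.IsFeasible S A)
    (hloc : ¬ ∃ X : Finset (Finset α), SetPacking.IsLocalImprovement S A X ∧ X.card ≤ 10)
    (hB : SetPacking.IsOptimum S B) :
    SetPacking.totalWeight B ≤ (4 / 3 : ℝ) * SetPacking.totalWeight A := by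
  classical
  -- Sets of cardinality `1` have weight `0`, and only larger ones take part in the charging.
  obtain ⟨hB, -⟩ := hB
  rw [SetPacking.totalWeight_eq_sum_filter hS hA.1, SetPacking.totalWeight_eq_sum_filter hS hB.1]
  set A₂ := A.filter (fun s => 2 ≤ s.card) with hA₂
  set B₂ := B.filter (fun s => 2 ≤ s.card) with hB₂
  have hAd : ∀ a ∈ A₂, ∀ a' ∈ A₂, a ≠ a' → Disjoint a a' := fun a ha a' ha' hne =>
    hA.2 (Finset.mem_coe.2 (Finset.mem_filter.1 ha).1)
      (Finset.mem_coe.2 (Finset.mem_filter.1 ha').1) hne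
  have hBd : ∀ b ∈ B₂, ∀ b' ∈ B₂, b ≠ b' →
      Disjoint (b.filter fun x => ¬ SetPacking.IsFreeElement A x)
        (b'.filter fun x => ¬ SetPacking.IsFreeElement A x) := fun b hb b' hb' hne =>
    (hB.2 (Finset.mem_coe.2 (Finset.mem_filter.1 hb).1)
      (Finset.mem_coe.2 (Finset.mem_filter.1 hb').1) hne).mono
      (Finset.filter_subset _ _) (Finset.filter_subset _ _)
  calc ∑ b ∈ B₂, SetPacking.weight b
      ≤ ∑ b ∈ B₂, ∑ x ∈ b.filter (fun x => ¬ SetPacking.IsFreeElement A x),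
          SetPacking.charge A B x := by
        refine Finset.sum_le_sum fun b hb => ?_
        obtain ⟨hb, h2⟩ := Finset.mem_filter.1 hb
        exact SetPacking.weight_le_sum_charge hS hA hB hloc hb h2
    _ = ∑ x ∈ B₂.biUnion (fun b => b.filter fun x => ¬ SetPacking.IsFreeElement A x),
          SetPacking.charge A B x := (Finset.sum_biUnion hBd).symm
    _ ≤ ∑ x ∈ A₂.biUnion id, SetPacking.charge A B x := by
        refine Finset.sum_le_sum_of_subset_of_nonneg (fun x hx => ?_)
          fun x _ _ => (SetPacking.charge_bounds A B x).1
        obtain ⟨b, -, hx⟩ := Finset.mem_biUnion.1 hx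
        have hnf := (Finset.mem_filter.1 hx).2
        unfold SetPacking.IsFreeElement at hnf
        push Not at hnf
        obtain ⟨a, ha, hxa, h1⟩ := hnf
        have := SetPacking.card_pos_of_mem hS (hA.1 ha)
        exact Finset.mem_biUnion.2 ⟨a, Finset.mem_filter.2 ⟨ha, by omega⟩, hxa⟩
    _ = ∑ a ∈ A₂, ∑ x ∈ a, SetPacking.charge A B x := Finset.sum_biUnion hAd
    _ ≤ ∑ a ∈ A₂, 4 / 3 * SetPacking.weight a := by
        refine Finset.sum_le_sum fun a ha => ?_
        obtain ⟨ha, h2⟩ := Finset.mem_filter.1 ha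
        exact SetPacking.sum_charge_le hS hA hB hloc ha h2
    _ = 4 / 3 * ∑ a ∈ A₂, SetPacking.weight a := by rw [Finset.mul_sum]
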